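/- Work with monads on the category $\mathbf{Sets}$. **Commutative additive monads.** For a monad $(T,\eta,\mu)$ let $\mathrm{st}\colon T(X)\times Y\to T(X\times Y)$, $\mathrm{st}(u,y)=T(x\mapsto (x,y))(u)$, be its canonical strength and $\mathrm{st}'\colon X\times T(Y)\to T(X\times Y)$ the version obtained by swapping. $T$ is *commutative* if $\mu\circ T(\mathrm{st}')\circ \mathrm{st}=\mu\circ T(\mathrm{st})\circ \mathrm{st}'\colon T(X)\times T(Y)\to T(X\times Y)$ for all $X,Y$. $T$ is *additive* if $T(0)\cong 1$ (where $0=\emptyset$) and all maps $\mathrm{bc}=\langle \mu\circ T([\eta,0]),\,\mu\circ T([0,\eta])\rangle\colon T(X+Y)\to T(X)\times T(Y)$ are bijective, where the zero map $0\colon X\to T(Y)$ is $X\to 1\cong T(0)\to T(Y)$. Let $\mathbf{ACMnd}$ be the category of commutative additive monads and monad maps, and $\mathbf{CSRng}$ the category of commutative semirings (with $0$ and $1$). **The functors.** $\mathcal{M}\colon\mathbf{CSRng}\to\mathbf{ACMnd}$ sends $S$ to the multiset monad $M_S$, with $M_S(X)$ the set of finitely supported functions $X\to S$, written as formal sums $\sum_i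 s_ix_i$, with $M_S(h)(\sum_i s_ix_i)=\sum_i s_ih(x_i)$, $\eta(x)=1x$ and $\mu(\sum_i s_i\varphi_i)=\sum_i s_i\cdot\varphi_i$; it sends $f\colon S\to R$ to the monad map $\sum_i s_ix_i\mapsto\sum_i f(s_i)x_i$. $\mathcal{E}\colon\mathbf{ACMnd}\to\mathbf{CSRng}$ sends $T$ to $T(1)$, with addition $T(\nabla)\circ\mathrm{bc}^{-1}$, zero $0\colon 1\to T(1)$, multiplication $\mu\circ T(\pi_2)\circ\mathrm{st}$ and unit $\eta_1$; it sends $\sigma$ to $\sigma_1$. **Involutions.** $\mathbf{ICSRng}$ is the category of commutative semirings $S$ with a unary operation $*$ that preserves $0,1,+,\cdot$ and satisfies $s^{**}=s$; its morphisms are the semiring homomorphisms that preserve $*$. $\mathbf{IACMnd}$ is the category of pairs $(T,\zeta)$ with $T\in\mathbf{ACMnd}$ and $\zeta\colon T\to T$ a monad map with $\zeta\circ\zeta=\mathrm{id}$; its morphisms $(T,\zeta)\to(T',\zeta')$ are the monad maps $\sigma\colon T\to T'$ with $\sigma\circ\zeta=\zeta'\circ\sigma$. **Lemma.** The functors $\mathcal{M}$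 and $\mathcal{E}$ restrict to functors $\mathcal{M}\colon\mathbf{ICSRng}\to\mathbf{IACMnd}$ and $\mathcal{E}\colon\mathbf{IACMnd}\to\mathbf{ICSRng}$, which commute with the functors that forget the involutions. The involution on $M_S$ is $\zeta_X(\sum_i s_ix_i)=\sum_i s_i^*x_i$, and the involution on $T(1)$ is $\zeta_1$. There is an adjunction $\mathcal{M}\dashv\mathcal{E}$ between $\mathbf{CSRng}$ and $\mathbf{ACMnd}$, under which $\sigma\colon M_S\to T$ corresponds to $S\to T(1)$, $s\mapsto\sigma_1(s\,\bullet)$, where $s\,\bullet\in M_S(1)$ is the multiset giving the unique element $\bullet$ of $1$ multiplicity $s$. It restricts to an adjunction $\mathcal{M}\dashv\mathcal{E}$ between $\mathbf{ICSRng}$ and $\mathbf{IACMnd}$: this is an adjunction of the restricted functors whose hom-set bijection is given by that of the first adjunction on underlying morphisms. -/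

import Mathlib

open CategoryTheory

universe u

namespace AddMonads

/-! ### Monads on the category of sets, elementwise -/

/-- The action `T(f)` of a monad on a function. -/
def fmap (T : Monad (Type u)) {X Y : Type u} (f : X → Y) (a : T.obj X) : T.obj Y :=
  T.map (↾f) a

/-- The unit `η_X : X → T(X)`. -/
def unit (T : Monad (Type u)) {X : Type u} (x : X) : T.obj X :=
  T.η.app X x

/-- The multiplication `μ_X : T(T(X)) → T(X)`. -/
def mult (T : Monad (Type u)) {X : Type u} (a : T.obj (T.obj X)) : T.obj X :=
  T.μ.app X a

/-- The canonical strength `st : T(X) × Y → T(X × Y)`, `st(u, y) = T(x ↦ (x, y))(u)`. -/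
def strength (T : Monad (Type u)) {X Y : Type u} (p : T.obj X × Y) : T.obj (X × Y) :=
  fmap T (fun x => (x, p.2)) p.1

/-- The swapped strength `st' = T(γ) ∘ st ∘ γ : X × T(Y) → T(X × Y)`. -/
def strengthSwap (T : Monad (Type u)) {X Y : Type u} (p : X × T.obj Y) : T.obj (X × Y) :=
  fmap T Prod.swap (strength T p.swap)

/-- A monad on sets is commutative if `μ ∘ T(st') ∘ st = μ ∘ T(st) ∘ st'` as maps
`T(X) × T(Y) → T(X × Y)`. -/
def IsCommutative (T : Monad (Type u)) : Prop :=
  ∀ (X Y : Type u) (p : T.obj X × T.obj Y),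
    mult T (fmap T (strengthSwap T) (strength T p)) =
      mult T (fmap T (strength T) (strengthSwap T p))

/-- The zero map `0_{X,Y} : X → 1 ≅ T(0) → T(Y)`, where `z` is the element of `T(0)`. -/
def zeroMap (T : Monad (Type u)) (z : T.obj PEmpty.{u + 1}) {X Y : Type u} (_ : X) : T.obj Y :=
  fmap T PEmpty.elim z

/-- The canonical map `bc = ⟨μ ∘ T(p₁), μ ∘ T(p₂)⟩ : T(X + Y) → T(X) × T(Y)`, where
`p₁ = [η, 0]` and `p₂ = [0, η]`. -/
def bc (T : Monad (Type u)) (z : T.obj PEmpty.{u + 1}) {X Y : Type u} (a : T.obj (X ⊕ Y)) :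
    T.obj X × T.obj Y :=
  (mult T (fmap T (Sum.elim (unit T) (zeroMap T z)) a),
    mult T (fmap T (Sum.elim (zeroMap T z) (unit T)) a))

/-- A monad on sets is additive if `T(0)` is a singleton and all maps `bc` are bijective. -/
def IsAdditive (T : Monad (Type u)) : Prop :=
  ∃ z : T.obj PEmpty.{u + 1}, (∀ w : T.obj PEmpty.{u + 1}, w = z) ∧
    ∀ X Y : Type u, Function.Bijective (bc T z : T.obj (X ⊕ Y) → T.obj X × T.obj Y)

/-- The category of commutative additive monads on sets, with all monad maps between them. -/
abbrev ACMnd : Type (u + 1) :=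
  ObjectProperty.FullSubcategory
    (fun T : Monad (Type u) => IsCommutative T ∧ IsAdditive T)

/-! ### The semiring `T(1)` -/

section Elementwise

variable (T : Monad (Type u))

theorem fmap_id {X : Type u} (a : T.obj X) : fmap T (fun x => x) a = a :=
  ConcreteCategory.congr_hom (T.map_id X) a

theorem fmap_fmap {X Y Z : Type u} (f : X → Y) (g : Y → Z) (a : T.obj X) :
    fmap T g (fmap T f a) = fmap T (fun x => g (f x)) a :=
  (ConcreteCategory.congr_hom (T.map_comp (↾f) (↾g)) a).symm

/-- Kleisli extension of `f` applied to `a`. -/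
def bind {X Y : Type u} (a : T.obj X) (f : X → T.obj Y) : T.obj Y :=
  mult T (fmap T f a)

theorem fmap_unit {X Y : Type u} (f : X → Y) (x : X) : fmap T f (unit T x) = unit T (f x) :=
  (ConcreteCategory.congr_hom (T.η.naturality (↾f)) x).symm

theorem fmap_mult {X Y : Type u} (f : X → Y) (a : T.obj (T.obj X)) :
    fmap T f (mult T a) = mult T (fmap T (fmap T f) a) :=
  (ConcreteCategory.congr_hom (T.μ.naturality (↾f)) a).symm

theorem mult_unit {X : Type u} (a : T.obj X) : mult T (unit T a) = a :=
  ConcreteCategory.congr_hom (T.left_unit X) a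

theorem mult_fmap_unit {X : Type u} (a : T.obj X) : mult T (fmap T (unit T) a) = a :=
  ConcreteCategory.congr_hom (T.right_unit X) a

theorem mult_mult {X : Type u} (a : T.obj (T.obj (T.obj X))) :
    mult T (mult T a) = mult T (fmap T (mult T) a) :=
  (ConcreteCategory.congr_hom (T.assoc X) a).symm

theorem unit_bind {X Y : Type u} (x : X) (f : X → T.obj Y) : bind T (unit T x) f = f x := by
  rw [bind, fmap_unit, mult_unit]

theorem bind_unit {X : Type u} (a : T.obj X) : bind T a (unit T) = a :=
  mult_fmap_unit T a

theorem fmap_bind {X Y Z : Type u} (f : X → Y) (a : T.obj X) (g : Y → T.obj Z) :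
    bind T (fmap T f a) g = bind T a (fun x => g (f x)) := by
  rw [bind, bind, fmap_fmap]

theorem fmap_of_bind {X Y Z : Type u} (a : T.obj X) (f : X → T.obj Y) (g : Y → Z) :
    fmap T g (bind T a f) = bind T a (fun x => fmap T g (f x)) := by
  rw [bind, bind, fmap_mult, fmap_fmap]

theorem bind_bind {X Y Z : Type u} (a : T.obj X) (f : X → T.obj Y) (g : Y → T.obj Z) :
    bind T (bind T a f) g = bind T a (fun x => bind T (f x) g) := by
  simp only [bind]
  rw [fmap_mult, mult_mult, fmap_fmap, fmap_fmap]

theorem fmap_eq_bind {X Y : Type u} (f : X → Y) (a : T.obj X) :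
    fmap T f a = bind T a (fun x => unit T (f x)) := by
  rw [← fmap_bind, bind_unit]

theorem bc_eq (z : T.obj PEmpty.{u + 1}) {X Y : Type u} (a : T.obj (X ⊕ Y)) :
    bc T z a = (bind T a (Sum.elim (unit T) (fun _ => fmap T PEmpty.elim z)),
      bind T a (Sum.elim (fun _ => fmap T PEmpty.elim z) (unit T))) :=
  rfl

end Elementwise

section Additive

variable {T : Monad (Type u)} (h : IsAdditive T)

/-- The zero element `0_{1,X}` of `T(X)`. -/
noncomputable def zero {X : Type u} : T.obj X :=
  zeroMap T h.choose PUnit.unit.{u + 1}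

/-- The addition `T(∇) ∘ bc⁻¹ : T(X) × T(X) → T(X)`. -/
noncomputable def add {X : Type u} (a b : T.obj X) : T.obj X :=
  fmap T (Sum.elim id id) ((Equiv.ofBijective _ (h.choose_spec.2 X X)).symm (a, b))

theorem exists_split {X Y : Type u} (a : T.obj X) (b : T.obj Y) :
    ∃ c : T.obj (X ⊕ Y), bind T c (Sum.elim (unit T) (fun _ => zero h)) = a ∧
      bind T c (Sum.elim (fun _ => zero h) (unit T)) = b := by
  obtain ⟨c, hc⟩ := (h.choose_spec.2 X Y).2 (a, b)
  exact ⟨c, congrArg Prod.fst hc, congrArg Prod.snd hc⟩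

theorem add_eq {X : Type u} {a b : T.obj X} {c : T.obj (X ⊕ X)}
    (ha : bind T c (Sum.elim (unit T) (fun _ => zero h)) = a)
    (hb : bind T c (Sum.elim (fun _ => zero h) (unit T)) = b) :
    add h a b = fmap T (Sum.elim id id) c := by
  have hc : (Equiv.ofBijective _ (h.choose_spec.2 X X)).symm (a, b) = c := by
    rw [Equiv.symm_apply_eq]
    exact (Prod.ext ha hb).symm
  rw [add, hc]

theorem fmap_zero {X Y : Type u} (f : X → Y) : fmap T f (zero h) = zero h := by
  unfold zero zeroMap
  rw [fmap_fmap]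
  congr 1
  funext x
  exact x.elim

theorem zero_bind {X Y : Type u} (f : X → T.obj Y) : bind T (zero h) f = zero h := by
  unfold zero zeroMap
  rw [fmap_bind, fmap_eq_bind]
  congr 1
  funext x
  exact x.elim

theorem bind_zero {X Y : Type u} (a : T.obj X) : bind T a (fun _ => (zero h : T.obj Y)) = zero h := by
  unfold zero zeroMap
  rw [← fmap_of_bind, h.choose_spec.1 (bind T a _)]

theorem add_comm {X : Type u} (a b : T.obj X) : add h a b = add h b a := by
  obtain ⟨c, ha, hb⟩ := exists_split h a b
  rw [add_eq h ha hb, add_eq h (c := fmap T Sum.swap c) (a := b) (b := a), fmap_fmap]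
  · congr 1; funext x; cases x <;> rfl
  · rw [fmap_bind, ← hb]; congr 1; funext x; cases x <;> rfl
  · rw [fmap_bind, ← ha]; congr 1; funext x; cases x <;> rfl

theorem add_zero {X : Type u} (a : T.obj X) : add h a (zero h) = a := by
  rw [add_eq h (c := fmap T Sum.inl a) (a := a), fmap_fmap]
  · exact fmap_id T a
  · rw [fmap_bind]; exact bind_unit T a
  · rw [fmap_bind]; exact bind_zero h a

theorem bind_add {X Y : Type u} (a b : T.obj X) (f : X → T.obj Y) :
    bind T (add h a b) f = add h (bind T a f) (bind T b f) := by
  obtain ⟨c, ha, hb⟩ := exists_split h a b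
  rw [add_eq h ha hb, add_eq h (a := bind T a f) (b := bind T b f)
    (c := bind T c (Sum.elim (fun x => fmap T Sum.inl (f x)) (fun x => fmap T Sum.inr (f x)))),
    fmap_bind, fmap_of_bind]
  · congr 1; funext x; cases x <;> exact ((fmap_fmap T _ _ _).trans (fmap_id T _)).symm
  · rw [← ha, bind_bind, bind_bind]
    congr 1; funext x
    cases x
    · exact (fmap_bind T _ _ _).trans ((bind_unit T _).trans (unit_bind T _ _).symm)
    · exact (fmap_bind T _ _ _).trans ((bind_zero h _).trans (zero_bind h _).symm)
  · rw [← hb, bind_bind, bind_bind]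
    congr 1; funext x
    cases x
    · exact (fmap_bind T _ _ _).trans ((bind_zero h _).trans (zero_bind h _).symm)
    · exact (fmap_bind T _ _ _).trans ((bind_unit T _).trans (unit_bind T _ _).symm)

theorem add_assoc {X : Type u} (a b c : T.obj X) :
    add h (add h a b) c = add h a (add h b c) := by
  obtain ⟨d, ha, hb⟩ := exists_split h a b
  obtain ⟨e, hd, hc⟩ := exists_split h d c
  have hbc : add h b c = bind T e (Sum.elim (Sum.elim (fun _ => zero h) (unit T)) (unit T)) := by
    rw [add_eq h (a := b) (b := c) (c := bind T e (Sum.elim (Sum.elim (fun _ => zero h)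
      (fun x => unit T (Sum.inl x))) (fun x => unit T (Sum.inr x)))), fmap_of_bind]
    · congr 1; funext x
      rcases x with (x | x) | x
      · exact fmap_zero h _
      · exact fmap_unit T _ _
      · exact fmap_unit T _ _
    · rw [← hb, ← hd, bind_bind, bind_bind]
      congr 1; funext x
      rcases x with (x | x) | x
      · exact (zero_bind h _).trans (unit_bind T (Sum.inl x) (Sum.elim (fun _ => zero h) (unit T))).symm
      · exact (unit_bind T _ _).trans (unit_bind T (Sum.inr x) (Sum.elim (fun _ => zero h) (unit T))).symm
      · exact (unit_bind T _ _).trans (zero_bind h _).symm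
    · rw [← hc, bind_bind]
      congr 1; funext x
      rcases x with (x | x) | x
      · exact zero_bind h _
      · exact unit_bind T _ _
      · exact unit_bind T _ _
  rw [add_eq h (a := add h a b) (b := c) (c := fmap T (Sum.map (Sum.elim id id) id) e),
    add_eq h (a := a) (b := add h b c)
      (c := fmap T (Sum.elim (Sum.elim Sum.inl Sum.inr) Sum.inr) e), fmap_fmap, fmap_fmap]
  · congr 1; funext x; rcases x with (x | x) | x <;> rfl
  · rw [← ha, ← hd, fmap_bind, bind_bind]
    congr 1; funext x
    rcases x with (x | x) | x
    · exact (unit_bind T _ _).symm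
    · exact (unit_bind T _ _).symm
    · exact (zero_bind h _).symm
  · rw [hbc, fmap_bind]
    congr 1; funext x; rcases x with (x | x) | x <;> rfl
  · rw [add_eq h ha hb, ← hd, fmap_bind, fmap_of_bind]
    congr 1; funext x
    rcases x with (x | x) | x
    · exact (fmap_unit T _ _).symm
    · exact (fmap_unit T _ _).symm
    · exact (fmap_zero h _).symm
  · rw [← hc, fmap_bind]
    congr 1; funext x; rcases x with (x | x) | x <;> rfl

end Additive

/-- The multiplication `μ ∘ T(π₂) ∘ st : T(1) × T(1) → T(1)`. -/
def mul (T : Monad (Type u)) (a b : T.obj PUnit.{u + 1}) : T.obj PUnit.{u + 1} :=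
  mult T (fmap T Prod.snd (strength T (a, b)))

theorem mul_eq (T : Monad (Type u)) (a b : T.obj PUnit.{u + 1}) :
    mul T a b = bind T a (fun _ => b) := by
  rw [mul, strength, fmap_fmap, bind]

theorem mul_comm {T : Monad (Type u)} (hT : IsCommutative T) (a b : T.obj PUnit.{u + 1}) :
    mul T a b = mul T b a := by
  have key := congrArg (fmap T (Prod.snd : PUnit.{u + 1} × PUnit.{u + 1} → PUnit.{u + 1}))
    (hT PUnit PUnit (a, b))
  simp only [strength, strengthSwap, fmap_mult, fmap_fmap, Prod.swap] at key
  rw [mul_eq, mul_eq, bind, bind]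
  have e : ∀ (c : T.obj PUnit.{u + 1}) (g : PUnit.{u + 1} → PUnit.{u + 1}), fmap T g c = c :=
    fun c g => fmap_id T c
  simpa only [e] using key

/-- The commutative semiring structure on `T(1)`, for a commutative additive monad `T`. -/
noncomputable abbrev evalSemiring (T : ACMnd.{u}) : CommSemiring (T.obj.obj PUnit.{u + 1}) :=
  letI : Zero (T.obj.obj PUnit.{u + 1}) := ⟨zero T.property.2⟩
  letI : One (T.obj.obj PUnit.{u + 1}) := ⟨unit T.obj PUnit.unit⟩
  letI : Add (T.obj.obj PUnit.{u + 1}) := ⟨add T.property.2⟩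
  letI : Mul (T.obj.obj PUnit.{u + 1}) := ⟨mul T.obj⟩
  { add a b := add T.property.2 a b
    zero := zero T.property.2
    mul a b := mul T.obj a b
    one := unit T.obj PUnit.unit
    add_assoc := add_assoc T.property.2
    zero_add a := (add_comm T.property.2 _ a).trans (add_zero T.property.2 a)
    add_zero := add_zero T.property.2
    add_comm := add_comm T.property.2
    left_distrib a b c := by
      change mul T.obj a (add T.property.2 b c) = add T.property.2 (mul T.obj a b) (mul T.obj a c)
      rw [mul_comm T.property.1 a, mul_comm T.property.1 a, mul_comm T.property.1 a]
      simp only [mul_eq]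
      exact bind_add T.property.2 b c _
    right_distrib a b c := by
      change mul T.obj (add T.property.2 a b) c = add T.property.2 (mul T.obj a c) (mul T.obj b c)
      simp only [mul_eq]
      exact bind_add T.property.2 a b _
    zero_mul a := (mul_eq T.obj _ a).trans (zero_bind T.property.2 _)
    mul_zero a := (mul_eq T.obj a _).trans (bind_zero T.property.2 a)
    mul_assoc a b c := by
      change mul T.obj (mul T.obj a b) c = mul T.obj a (mul T.obj b c)
      simp only [mul_eq]
      exact bind_bind T.obj _ _ _
    one_mul a := (mul_eq T.obj _ a).trans (unit_bind T.obj _ _)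
    mul_one a := (mul_eq T.obj a _).trans (bind_unit T.obj a)
    mul_comm := mul_comm T.property.1
    nsmul := nsmulRec
    npow := npowRec }

section Maps

variable {T S : Monad (Type u)} (σ : T ⟶ S)

theorem app_fmap {X Y : Type u} (f : X → Y) (a : T.obj X) :
    σ.app Y (fmap T f a) = fmap S f (σ.app X a) :=
  ConcreteCategory.congr_hom (σ.naturality (↾f)) a

theorem app_unit {X : Type u} (x : X) : σ.app X (unit T x) = unit S x :=
  ConcreteCategory.congr_hom (σ.app_η X) x

theorem app_bind {X Y : Type u} (a : T.obj X) (f : X → T.obj Y) :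
    σ.app Y (bind T a f) = bind S (σ.app X a) (fun x => σ.app Y (f x)) := by
  have h1 : σ.app Y (mult T (fmap T f a)) =
      mult S (σ.app _ (T.map (σ.app Y) (fmap T f a))) :=
    ConcreteCategory.congr_hom (σ.app_μ Y) _
  refine h1.trans ?_
  change mult S (σ.app _ (fmap T (σ.app Y) (fmap T f a))) = _
  rw [fmap_fmap, app_fmap, bind]

theorem app_zero (hT : IsAdditive T) (hS : IsAdditive S) {X : Type u} :
    σ.app X (zero hT) = zero hS := by
  unfold zero zeroMap
  rw [app_fmap, hS.choose_spec.1 (σ.app _ _)]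

theorem app_add (hT : IsAdditive T) (hS : IsAdditive S) {X : Type u} (a b : T.obj X) :
    σ.app X (add hT a b) = add hS (σ.app X a) (σ.app X b) := by
  obtain ⟨c, ha, hb⟩ := exists_split hT a b
  rw [add_eq hT ha hb, add_eq hS (a := σ.app X a) (b := σ.app X b) (c := σ.app _ c), app_fmap]
  · rw [← ha, app_bind]
    congr 1; funext x
    cases x
    · exact (app_unit σ _).symm
    · exact (app_zero σ hT hS).symm
  · rw [← hb, app_bind]
    congr 1; funext x
    cases x
    · exact (app_zero σ hT hS).symm
    · exact (app_unit σ _).symm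

end Maps

/-- The evaluation functor `ℰ`, sending a commutative additive monad `T` to the commutative
semiring `T(1)` and a monad map `σ` to its component `σ_1`. -/
noncomputable def evalFunctor : ACMnd.{u} ⥤ CommSemiRingCat.{u} where
  obj T := @CommSemiRingCat.of (T.obj.obj PUnit.{u + 1}) (evalSemiring T)
  map {T S} σ :=
    letI := evalSemiring T
    letI := evalSemiring S
    CommSemiRingCat.ofHom
      { toFun := fun a => σ.hom.app PUnit.{u + 1} a
        map_one' := app_unit σ.hom _
        map_mul' := fun a b => by
          change σ.hom.app _ (mul T.obj a b) = mul S.obj (σ.hom.app _ a) (σ.hom.app _ b)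
          rw [mul_eq, mul_eq, app_bind]
        map_zero' := app_zero σ.hom T.property.2 S.property.2
        map_add' := app_add σ.hom T.property.2 S.property.2 }
  map_id _ := rfl
  map_comp _ _ := rfl

/-! ### Multiset monads -/

theorem type_ext {X Y : Type u} {f g : X ⟶ Y} (h : ∀ x : X, f x = g x) : f = g :=
  ConcreteCategory.hom_ext f g h

theorem sum_smul_mapDomain {S X Y Z : Type u} [CommSemiring S] (g : X → Y) (F : Y → (Z →₀ S))
    (φ : X →₀ S) :
    (Finsupp.mapDomain g φ).sum (fun y s => s • F y) = φ.sum (fun x s => s • F (g x)) :=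
  Finsupp.sum_mapDomain_index (h := fun y s => s • F y) (fun _ => zero_smul _ _)
    (fun _ _ _ => add_smul _ _ _)

/-- The multiset monad `M_S` of a commutative semiring `S`: the set `M_S(X)` consists of the
finitely supported functions `X → S`, written as formal sums `∑ sᵢ xᵢ`. -/
noncomputable def multisetMonad (S : Type u) [CommSemiring S] : Monad (Type u) where
  obj X := X →₀ S
  map f := ↾(fun φ => Finsupp.mapDomain f φ)
  map_id X := type_ext fun φ : X →₀ S => Finsupp.mapDomain_id
  map_comp {X Y Z} f g := type_ext fun φ : X →₀ S =>
    Finsupp.mapDomain_comp (f := (f : X → Y)) (g := (g : Y → Z))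
  η := { app := fun X => ↾(fun x => Finsupp.single x 1)
         naturality := fun X Y f => type_ext fun x : X => (Finsupp.mapDomain_single).symm }
  μ := { app := fun X => ↾(fun Φ : (X →₀ S) →₀ S => Φ.sum (fun φ s => s • φ))
         naturality := fun X Y f => type_ext fun Φ : (X →₀ S) →₀ S => by
          change Finsupp.sum (Finsupp.mapDomain (fun φ : X →₀ S => Finsupp.mapDomain f φ) Φ)
            (fun φ s => s • φ) = Finsupp.mapDomain f (Finsupp.sum Φ (fun φ s => s • φ))
          refine (sum_smul_mapDomain _ (fun φ => φ) Φ).trans ?_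
          rw [Finsupp.sum, Finsupp.sum, Finsupp.mapDomain_finsetSum]
          simp only [Finsupp.mapDomain_smul] }
  assoc X := type_ext fun Φ : ((X →₀ S) →₀ S) →₀ S => by
    change Finsupp.sum (Finsupp.mapDomain (fun Ψ : (X →₀ S) →₀ S => Ψ.sum (fun φ s => s • φ)) Φ)
      (fun φ s => s • φ) = Finsupp.sum (Finsupp.sum Φ (fun φ s => s • φ)) (fun φ s => s • φ)
    refine (sum_smul_mapDomain _ (fun φ => φ) Φ).trans (Eq.trans ?_ (Finsupp.sum_sum_index
      (h := fun (φ : X →₀ S) (s : S) => s • φ)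
      (fun _ => zero_smul _ _) (fun _ _ _ => add_smul _ _ _)).symm)
    refine Finsupp.sum_congr fun Ψ _ => ?_
    refine (Finsupp.smul_sum).trans (Eq.trans ?_ (Finsupp.sum_smul_index
      (h := fun (φ : X →₀ S) (s : S) => s • φ) (fun _ => zero_smul _ _)).symm)
    simp only [mul_smul]
  left_unit X := type_ext fun φ : X →₀ S => by
    change Finsupp.sum (Finsupp.single φ (1 : S)) (fun φ s => s • φ) = φ
    exact (Finsupp.sum_single_index (h := fun (φ : X →₀ S) (s : S) => s • φ)
      (zero_smul _ _)).trans (one_smul _ _)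
  right_unit X := type_ext fun φ : X →₀ S => by
    change Finsupp.sum (Finsupp.mapDomain (fun x => Finsupp.single x (1 : S)) φ)
      (fun φ s => s • φ) = φ
    refine (sum_smul_mapDomain _ (fun φ => φ) φ).trans ?_
    simp only [Finsupp.smul_single, smul_eq_mul, mul_one]
    exact Finsupp.sum_single φ

section Multiset

variable (S : Type u) [CommSemiring S]

theorem multiset_bind {X Y : Type u} (φ : X →₀ S) (f : X → (Y →₀ S)) :
    mult (multisetMonad S) (fmap (multisetMonad S) f φ) = φ.sum (fun x s => s • f x) :=
  sum_smul_mapDomain f (fun ψ => ψ) φ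

theorem sum_smul_comm {X Y : Type u} (φ : X →₀ S) (ψ : Y →₀ S) :
    φ.sum (fun x s => s • Finsupp.mapDomain (fun y => (x, y)) ψ) =
      ψ.sum (fun y t => t • Finsupp.mapDomain (fun x => (x, y)) φ) := by
  simp only [Finsupp.mapDomain, Finsupp.smul_sum, Finsupp.smul_single, smul_eq_mul]
  rw [Finsupp.sum_comm]
  simp only [_root_.mul_comm]

theorem multiset_isCommutative : IsCommutative (multisetMonad S) := by
  rintro X Y ⟨φ, ψ⟩
  have e1 : (fun x : X => strengthSwap (multisetMonad S) (x, ψ)) =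
      fun x => Finsupp.mapDomain (fun y => (x, y)) ψ :=
    funext fun x => fmap_fmap (multisetMonad S) _ _ ψ
  have e2 : strengthSwap (multisetMonad S) (φ, ψ) = Finsupp.mapDomain (fun y => (φ, y)) ψ :=
    fmap_fmap (multisetMonad S) _ _ ψ
  have h1 : mult (multisetMonad S) (fmap (multisetMonad S) (strengthSwap (multisetMonad S))
      (strength (multisetMonad S) (φ, ψ))) =
      mult (multisetMonad S) (fmap (multisetMonad S)
        (fun x : X => strengthSwap (multisetMonad S) (x, ψ)) φ) :=
    congrArg _ (fmap_fmap (multisetMonad S) _ _ φ)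
  have h2 : mult (multisetMonad S) (fmap (multisetMonad S) (strength (multisetMonad S))
      (strengthSwap (multisetMonad S) (φ, ψ))) =
      mult (multisetMonad S) (fmap (multisetMonad S)
        (fun y : Y => strength (multisetMonad S) (φ, y)) ψ) := by
    rw [e2]
    exact congrArg _ (fmap_fmap (multisetMonad S) _ _ ψ)
  rw [h1, h2, e1]
  exact (multiset_bind S φ _).trans ((sum_smul_comm S φ ψ).trans (multiset_bind S ψ _).symm)

theorem sum_smul_inl {X Y : Type u} (χ : X ⊕ Y →₀ S) :
    χ.sum (fun z s => s • Sum.elim (fun x => Finsupp.single x (1 : S)) (fun _ => 0) z) =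
      (Finsupp.sumFinsuppEquivProdFinsupp χ).1 := by
  induction χ using Finsupp.induction_linear with
  | zero =>
    ext x
    simp
  | add f g hf hg =>
    rw [Finsupp.sum_add_index' (h := fun (z : X ⊕ Y) (s : S) => s •
      Sum.elim (fun x => Finsupp.single x (1 : S)) (fun _ => 0) z)
      (fun _ => zero_smul _ _) (fun _ _ _ => add_smul _ _ _), hf, hg]
    ext x
    simp
  | single z s =>
    rw [Finsupp.sum_single_index (h := fun (z : X ⊕ Y) (s : S) => s •
      Sum.elim (fun x => Finsupp.single x (1 : S)) (fun _ => 0) z)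
      (zero_smul _ _)]
    classical
    ext x
    cases z <;> simp [Finsupp.single_apply]

theorem sum_smul_inr {X Y : Type u} (χ : X ⊕ Y →₀ S) :
    χ.sum (fun z s => s • Sum.elim (fun _ => 0) (fun y => Finsupp.single y (1 : S)) z) =
      (Finsupp.sumFinsuppEquivProdFinsupp χ).2 := by
  induction χ using Finsupp.induction_linear with
  | zero =>
    ext x
    simp
  | add f g hf hg =>
    rw [Finsupp.sum_add_index' (h := fun (z : X ⊕ Y) (s : S) => s •
      Sum.elim (fun _ => 0) (fun y => Finsupp.single y (1 : S)) z)
      (fun _ => zero_smul _ _) (fun _ _ _ => add_smul _ _ _), hf, hg]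
    ext x
    simp
  | single z s =>
    rw [Finsupp.sum_single_index (h := fun (z : X ⊕ Y) (s : S) => s •
      Sum.elim (fun _ => 0) (fun y => Finsupp.single y (1 : S)) z)
      (zero_smul _ _)]
    classical
    ext x
    cases z <;> simp [Finsupp.single_apply]

theorem multiset_isAdditive : IsAdditive (multisetMonad S) := by
  refine ⟨(0 : PEmpty.{u + 1} →₀ S), fun w => Finsupp.ext fun x => x.elim, fun X Y => ?_⟩
  have hbc : (bc (multisetMonad S) (0 : PEmpty.{u + 1} →₀ S) :
      (X ⊕ Y →₀ S) → (X →₀ S) × (Y →₀ S)) = Finsupp.sumFinsuppEquivProdFinsupp :=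
    funext fun χ => Prod.ext ((multiset_bind S χ _).trans (sum_smul_inl S χ))
      ((multiset_bind S χ _).trans (sum_smul_inr S χ))
  have hb : Function.Bijective (Finsupp.sumFinsuppEquivProdFinsupp :
      (X ⊕ Y →₀ S) → (X →₀ S) × (Y →₀ S)) := Equiv.bijective _
  rw [← hbc] at hb
  exact hb

end Multiset

/-- The monad map `M_S → M_R`, `∑ sᵢ xᵢ ↦ ∑ f(sᵢ) xᵢ`, of a semiring homomorphism `f`. -/
noncomputable def multisetMap {S R : Type u} [CommSemiring S] [CommSemiring R] (f : S →+* R) :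
    multisetMonad S ⟶ multisetMonad R where
  app X := ↾(fun φ : X →₀ S => φ.mapRange f (map_zero f))
  naturality X Y g := type_ext fun φ : X →₀ S =>
    (Finsupp.mapDomain_mapRange g φ f (map_zero f) (map_add f)).symm
  app_η X := type_ext fun x : X => by
    change Finsupp.mapRange f (map_zero f) (Finsupp.single x 1) = Finsupp.single x 1
    rw [Finsupp.mapRange_single, map_one]
  app_μ X := type_ext fun Φ : (X →₀ S) →₀ S => by
    change Finsupp.mapRange.addMonoidHom (f : S →+ R) (Finsupp.sum Φ (fun φ s => s • φ)) =
      Finsupp.sum (Finsupp.mapRange f (map_zero f) (Finsupp.mapDomain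
        (fun φ : X →₀ S => φ.mapRange f (map_zero f)) Φ)) (fun φ s => s • φ)
    have h1 : Finsupp.sum (Finsupp.mapRange f (map_zero f) (Finsupp.mapDomain
        (fun φ : X →₀ S => φ.mapRange f (map_zero f)) Φ)) (fun φ s => s • φ) =
        Φ.sum (fun φ s => f s • φ.mapRange f (map_zero f)) :=
      (Finsupp.sum_mapRange_index (h := fun (φ : X →₀ R) (s : R) => s • φ)
        (fun _ => zero_smul _ _)).trans
        (Finsupp.sum_mapDomain_index (h := fun (φ : X →₀ R) (s : S) => f s • φ)
          (fun _ => by rw [map_zero, zero_smul]) (fun _ _ _ => by rw [map_add, add_smul]))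
    rw [h1, map_finsuppSum]
    refine Finsupp.sum_congr fun φ _ => Finsupp.ext fun x => ?_
    simp

/-- The multiset functor `ℳ`, sending a commutative semiring `S` to the commutative additive
monad `M_S`. -/
noncomputable def multisetFunctor : CommSemiRingCat.{u} ⥤ ACMnd.{u} where
  obj S := ⟨multisetMonad S, multiset_isCommutative S, multiset_isAdditive S⟩
  map f := ObjectProperty.homMk (multisetMap f.hom)
  map_id S := by
    apply ObjectProperty.hom_ext
    apply MonadHom.ext'
    funext X
    exact type_ext fun φ : X →₀ S => Finsupp.mapRange_id φ
  map_comp {S _ _} f g := by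
    apply ObjectProperty.hom_ext
    apply MonadHom.ext'
    funext X
    exact type_ext fun φ : X →₀ S => Finsupp.ext fun _ => rfl

/-! ### Involutions -/

/-- An involutive commutative semiring: a commutative semiring with an operation `star`
preserving `0`, `1`, `+`, `·` and satisfying `star (star s) = s`. (For commutative semirings
`star (s * t) = star t * star s` is the same as `star (s * t) = star s * star t`.) -/
structure ICSRng : Type (u + 1) where
  carrier : Type u
  [commSemiring : CommSemiring carrier]
  [starRing : StarRing carrier]

attribute [instance] ICSRng.commSemiring ICSRng.starRing

/-- A homomorphism of involutive semirings: a semiring homomorphism preserving `star`. -/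
@[ext]
structure ICSRng.Hom (S R : ICSRng.{u}) : Type u where
  toRingHom : S.carrier →+* R.carrier
  map_star : ∀ s : S.carrier, toRingHom (star s) = star (toRingHom s)

instance : Category ICSRng.{u} where
  Hom S R := ICSRng.Hom S R
  id S := ⟨RingHom.id S.carrier, fun _ => rfl⟩
  comp f g := ⟨g.toRingHom.comp f.toRingHom, fun s => by
    simp only [RingHom.comp_apply, f.map_star, g.map_star]⟩

/-- The functor forgetting the involution. -/
def ICSRng.forget : ICSRng.{u} ⥤ CommSemiRingCat.{u} where
  obj S := CommSemiRingCat.of S.carrier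
  map f := CommSemiRingCat.ofHom f.toRingHom

/-- An involutive commutative additive monad: a commutative additive monad `T` on sets with a
monad map `ζ : T → T` satisfying `ζ ∘ ζ = id`. -/
structure IACMnd : Type (u + 1) where
  toACMnd : ACMnd.{u}
  ζ : toACMnd ⟶ toACMnd
  ζ_comp_ζ : ζ ≫ ζ = 𝟙 toACMnd

/-- A morphism of involutive monads: a monad map `σ` with `σ ∘ ζ = ζ' ∘ σ`. -/
@[ext]
structure IACMnd.Hom (T T' : IACMnd.{u}) : Type (u + 1) where
  hom : T.toACMnd ⟶ T'.toACMnd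
  comm : T.ζ ≫ hom = hom ≫ T'.ζ

instance : Category IACMnd.{u} where
  Hom T T' := IACMnd.Hom T T'
  id T := ⟨𝟙 T.toACMnd, by rw [Category.comp_id, Category.id_comp]⟩
  comp σ τ := ⟨σ.hom ≫ τ.hom, by rw [← Category.assoc, σ.comm, Category.assoc, τ.comm,
    Category.assoc]⟩
  id_comp σ := IACMnd.Hom.ext (Category.id_comp σ.hom)
  comp_id σ := IACMnd.Hom.ext (Category.comp_id σ.hom)
  assoc σ τ υ := IACMnd.Hom.ext (Category.assoc σ.hom τ.hom υ.hom)

/-- The functor forgetting the involution. -/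
def IACMnd.forget : IACMnd.{u} ⥤ ACMnd.{u} where
  obj T := T.toACMnd
  map σ := σ.hom

/-! ### The restricted functors -/

/-- The involution `∑ sᵢ xᵢ ↦ ∑ sᵢ* xᵢ` on the multiset monad of an involutive semiring. -/
noncomputable def multisetInvolution (S : ICSRng.{u}) :
    multisetFunctor.obj (ICSRng.forget.obj S) ⟶ multisetFunctor.obj (ICSRng.forget.obj S) :=
  ObjectProperty.homMk (multisetMap (starRingEnd S.carrier))

/-- The functor `ℳ` on involutive commutative semirings, with values in involutive commutative
additive monads: `S ↦ (M_S, ∑ sᵢ xᵢ ↦ ∑ sᵢ* xᵢ)`. -/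
noncomputable def involutiveMultisetFunctor : ICSRng.{u} ⥤ IACMnd.{u} where
  obj S :=
    { toACMnd := multisetFunctor.obj (ICSRng.forget.obj S)
      ζ := multisetInvolution S
      ζ_comp_ζ := by
        apply ObjectProperty.hom_ext
        apply MonadHom.ext'
        funext X
        exact type_ext fun φ : X →₀ S.carrier => Finsupp.ext fun x => star_star (φ x) }
  map {S R} f :=
    { hom := multisetFunctor.map (ICSRng.forget.map f)
      comm := by
        apply ObjectProperty.hom_ext
        apply MonadHom.ext'
        funext X
        exact type_ext fun φ : X →₀ S.carrier => Finsupp.ext fun x => f.map_star (φ x) }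
  map_id S := IACMnd.Hom.ext (multisetFunctor.map_id (ICSRng.forget.obj S))
  map_comp f g := IACMnd.Hom.ext
    (multisetFunctor.map_comp (ICSRng.forget.map f) (ICSRng.forget.map g))

/-- The involutive semiring structure on `T(1)`, with involution `ζ_1`. -/
noncomputable abbrev evalStarRing (T : IACMnd.{u}) :
    letI := evalSemiring T.toACMnd
    StarRing (T.toACMnd.obj.obj PUnit.{u + 1}) :=
  letI := evalSemiring T.toACMnd
  { star := fun a => T.ζ.hom.app PUnit.{u + 1} a
    star_involutive := fun a => by
      have h := congrArg (fun σ : T.toACMnd ⟶ T.toACMnd => σ.hom.app PUnit.{u + 1}) T.ζ_comp_ζ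
      exact ConcreteCategory.congr_hom h a
    star_mul := fun a b =>
      ((evalFunctor.map T.ζ).hom.map_mul a b).trans (mul_comm T.toACMnd.property.1 _ _)
    star_add := fun a b => (evalFunctor.map T.ζ).hom.map_add a b }

/-- The functor `ℰ` on involutive commutative additive monads, with values in involutive
commutative semirings: `(T, ζ) ↦ (T(1), ζ_1)`. -/
noncomputable def involutiveEvalFunctor : IACMnd.{u} ⥤ ICSRng.{u} where
  obj T :=
    letI := evalSemiring T.toACMnd
    letI := evalStarRing T
    { carrier := T.toACMnd.obj.obj PUnit.{u + 1} }
  map {T T'} σ :=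
    { toRingHom := (evalFunctor.map σ.hom).hom
      map_star := fun a => by
        have h := congrArg (fun τ : T.toACMnd ⟶ T'.toACMnd => τ.hom.app PUnit.{u + 1}) σ.comm
        exact ConcreteCategory.congr_hom h a }
  map_id _ := rfl
  map_comp _ _ := rfl

end AddMonads

namespace AddMonads

/-! ### The additive structure of `T(X)` -/

section Additive

variable {T : Monad (Type u)} (h : IsAdditive T)

/-! Additivity of `T` makes every `T(X)` a commutative monoid. Monad maps preserve this structure,
and Kleisli extension is additive in both arguments (`bind_add`, `bind_add_right`). On `M_S(X)` it
is pointwise addition (`multiset_add`), so every element is a finite sum of terms `s x`, each the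
image of `s •` under `M_S(x)` for `x : 1 → X`.

Hence a monad map `σ : M_S → T` must send `∑ sᵢ xᵢ` to `∑ T(xᵢ)(σ_1(sᵢ •))`, so it is determined by
the semiring homomorphism `s ↦ σ_1(s •)`. Conversely, for `g : S → T(1)` the same formula defines
`liftFun g`. Compatibility with `η` is `g(1) = 1`; compatibility with `μ` (`liftFun_mult`) reduces
by additivity to single terms, where it is multiplicativity of `g`.

The involution of `M_S` is `ℳ` applied to `*`, and that of `T(1)` is `ℰ` applied to `ζ`. By
naturality of the bijection, `σ` commutes with the involutions exactly when its transpose does, so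
the bijection restricts. -/

theorem bind_add_right {X Y : Type u} (a : T.obj X) (f g : X → T.obj Y) :
    bind T a (fun x => add h (f x) (g x)) = add h (bind T a f) (bind T a g) := by
  -- If `c x` represents the pair `(f x, g x)` under `bc`, then `bind T a c` represents the pair of
  -- Kleisli extensions.
  choose c hf hg using fun x => exists_split h (f x) (g x)
  rw [add_eq h (a := bind T a f) (b := bind T a g) (c := bind T a c), fmap_of_bind]
  · congr 1; funext x; exact add_eq h (hf x) (hg x)
  · rw [bind_bind]; congr 1; funext x; exact hf x
  · rw [bind_bind]; congr 1; funext x; exact hg x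

theorem fmap_add {X Y : Type u} (f : X → Y) (a b : T.obj X) :
    fmap T f (add h a b) = add h (fmap T f a) (fmap T f b) := by
  simp only [fmap_eq_bind, bind_add]

/-- The commutative monoid structure on `T(X)`, for an additive monad `T`. -/
noncomputable abbrev addCommMonoid (X : Type u) : AddCommMonoid (T.obj X) where
  add := add h
  zero := zero h
  add_assoc := add_assoc h
  zero_add a := (add_comm h _ a).trans (add_zero h a)
  add_zero := add_zero h
  add_comm := add_comm h
  nsmul := @nsmulRec _ ⟨zero h⟩ ⟨add h⟩

end Additive

/-! ### The additive structure of multiset monads. -/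

theorem multiset_zero {S : Type u} [CommSemiring S] {X : Type u} :
    (zero (multiset_isAdditive S) : (multisetMonad S).obj X) = (0 : X →₀ S) := by
  -- The element of `M_S(0)` in the definition of `zero` is picked by choice, but all functions on
  -- the empty set agree.
  have hz : (multiset_isAdditive S).choose = (0 : PEmpty.{u + 1} →₀ S) :=
    Finsupp.ext fun x => x.elim
  exact (congrArg (fmap (multisetMonad S) PEmpty.elim) hz).trans
    (Finsupp.mapDomain_zero (f := (PEmpty.elim : PEmpty.{u + 1} → X)))

/-- The multiset `inl φ + inr ψ` is the preimage of `(φ, ψ)` under `bc`. Both components of `bc` are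
Kleisli extensions, so one evaluation serves for both. -/
theorem multiset_bind_inl_add_inr {S : Type u} [CommSemiring S] {X Y : Type u} (φ ψ : X →₀ S)
    (f : X ⊕ X → (Y →₀ S)) (φ' ψ' : Y →₀ S)
    (hφ : bind (multisetMonad S) (X := X) (Y := Y) φ (fun x => f (Sum.inl x)) = φ')
    (hψ : bind (multisetMonad S) (X := X) (Y := Y) ψ (fun x => f (Sum.inr x)) = ψ') :
    bind (multisetMonad S) (X := X ⊕ X) (Y := Y)
      (Finsupp.mapDomain Sum.inl φ + Finsupp.mapDomain Sum.inr ψ : X ⊕ X →₀ S) f =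
        (φ' + ψ' : Y →₀ S) := by
  refine (multiset_bind S _ f).trans ((Finsupp.sum_add_index' (h := fun z s => s • f z)
    (fun _ => zero_smul _ _) (fun _ _ _ => add_smul _ _ _)).trans ?_)
  rw [sum_smul_mapDomain, sum_smul_mapDomain]
  exact congrArg₂ _ ((multiset_bind S φ _).symm.trans hφ) ((multiset_bind S ψ _).symm.trans hψ)

/-- The codiagonal merges the preimage `inl φ + inr ψ` of `(φ, ψ)` into the pointwise sum. This lets
`app_add` apply to formal sums. -/
theorem multiset_add {S : Type u} [CommSemiring S] {X : Type u} (φ ψ : X →₀ S) :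
    add (multiset_isAdditive S) (X := X) φ ψ = (φ + ψ : X →₀ S) := by
  have h0 (χ : X →₀ S) : bind (multisetMonad S) (X := X) (Y := X) χ
      (fun _ => zero (multiset_isAdditive S)) = (0 : X →₀ S) :=
    (bind_zero (multiset_isAdditive S) χ).trans multiset_zero
  have hl := (multiset_bind_inl_add_inr φ ψ
    (Sum.elim (unit (multisetMonad S)) (fun _ => zero (multiset_isAdditive S))) φ 0
    (bind_unit (multisetMonad S) φ) (h0 ψ)).trans (_root_.add_zero φ)
  have hr := (multiset_bind_inl_add_inr φ ψ
    (Sum.elim (fun _ => zero (multiset_isAdditive S)) (unit (multisetMonad S))) 0 ψ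
    (h0 φ) (bind_unit (multisetMonad S) ψ)).trans (_root_.zero_add ψ)
  refine (add_eq (multiset_isAdditive S) hl hr).trans ?_
  refine (Finsupp.mapDomain_add (f := Sum.elim id id)).trans ?_
  rw [← Finsupp.mapDomain_comp, ← Finsupp.mapDomain_comp]
  exact congrArg₂ _ Finsupp.mapDomain_id Finsupp.mapDomain_id

/-! ### Monad maps out of multiset monads -/

section Lift

variable {S : CommSemiRingCat.{u}} {T : ACMnd.{u}} (g : S ⟶ evalFunctor.obj T)

/-- The element `T(x)(g(s))` of `T(X)`, for `g : S → T(1)` and `x : 1 → X`. -/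
noncomputable def weight {X : Type u} (x : X) (s : S) : T.obj.obj X :=
  fmap T.obj (fun _ : PUnit.{u + 1} => x) (g.hom s)

theorem weight_zero {X : Type u} (x : X) : weight g x (0 : S) = zero T.property.2 :=
  (congrArg (fmap T.obj _) (map_zero g.hom)).trans (fmap_zero T.property.2 _)

theorem weight_one {X : Type u} (x : X) : weight g x (1 : S) = unit T.obj x :=
  (congrArg (fmap T.obj _) (map_one g.hom)).trans (fmap_unit T.obj _ _)

theorem weight_add {X : Type u} (x : X) (s t : S) :
    weight g x (s + t) = add T.property.2 (weight g x s) (weight g x t) :=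
  (congrArg (fmap T.obj _) (map_add g.hom s t)).trans (fmap_add T.property.2 _ _ _)

theorem weight_punit (s : S) : weight g PUnit.unit.{u + 1} s = g.hom s :=
  fmap_id T.obj _

theorem fmap_weight {X Y : Type u} (f : X → Y) (x : X) (s : S) :
    fmap T.obj f (weight g x s) = weight g (f x) s :=
  fmap_fmap T.obj _ _ _

/-- A weight is pushed forward from `1` along `x`, so only the value `f x` enters; what remains is
the scalar action of `g(s)` on `T(Y)`. -/
theorem weight_bind {X Y : Type u} (x : X) (s : S) (f : X → T.obj.obj Y) :
    bind T.obj (weight g x s) f = bind T.obj (weight g PUnit.unit.{u + 1} s) (fun _ => f x) :=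
  (fmap_bind T.obj _ _ _).trans (congrArg (bind T.obj · (fun _ => f x)) (weight_punit g s).symm)

/-- For `X = 1` this is multiplicativity of `g`, since the product of `T(1)` is Kleisli extension by
a constant map; the general case is its image under `T(x)`. -/
theorem weight_mul {X : Type u} (x : X) (s t : S) :
    weight g x (s * t) = bind T.obj (weight g PUnit.unit.{u + 1} s) (fun _ => weight g x t) := by
  have h : weight g PUnit.unit.{u + 1} (s * t) =
      bind T.obj (weight g PUnit.unit.{u + 1} s) (fun _ => weight g PUnit.unit.{u + 1} t) := by
    rw [← mul_eq, weight_punit, weight_punit, weight_punit]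
    exact map_mul g.hom s t
  rw [← fmap_weight g (fun _ => x) PUnit.unit.{u + 1}, h, fmap_of_bind]
  simp only [fmap_weight]

/-- The map `M_S(X) → T(X)`, `∑ sᵢ xᵢ ↦ ∑ T(xᵢ)(g(sᵢ))`, of `g : S → T(1)`. -/
noncomputable def liftFun (X : Type u) (φ : X →₀ S) : T.obj.obj X :=
  letI := addCommMonoid T.property.2 X
  φ.sum (weight g)

theorem liftFun_zero (X : Type u) : liftFun g X 0 = zero T.property.2 :=
  rfl

theorem liftFun_single {X : Type u} (x : X) (s : S) :
    liftFun g X (Finsupp.single x s) = weight g x s :=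
  letI := addCommMonoid T.property.2 X
  Finsupp.sum_single_index (weight_zero g x)

theorem liftFun_add {X : Type u} (φ ψ : X →₀ S) :
    liftFun g X (φ + ψ) = add T.property.2 (liftFun g X φ) (liftFun g X ψ) :=
  letI := addCommMonoid T.property.2 X
  Finsupp.sum_add_index' (weight_zero g) (weight_add g)

theorem liftFun_mapDomain {X Y : Type u} (f : X → Y) (φ : X →₀ S) :
    liftFun g Y (φ.mapDomain f) = fmap T.obj f (liftFun g X φ) := by
  induction φ using Finsupp.induction_linear with
  | zero => rw [Finsupp.mapDomain_zero, liftFun_zero, liftFun_zero, fmap_zero]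
  | add φ ψ hφ hψ => rw [Finsupp.mapDomain_add, liftFun_add, liftFun_add, fmap_add, hφ, hψ]
  | single x s => rw [Finsupp.mapDomain_single, liftFun_single, liftFun_single, fmap_weight]

/-- Both sides are additive in `φ`, the right one by `bind_add_right`, so single terms suffice, and
there it is `weight_mul`. -/
theorem liftFun_smul {X : Type u} (s : S) (φ : X →₀ S) :
    liftFun g X (s • φ) =
      bind T.obj (weight g PUnit.unit.{u + 1} s) (fun _ => liftFun g X φ) := by
  induction φ using Finsupp.induction_linear with
  | zero => rw [smul_zero, liftFun_zero, bind_zero]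
  | add φ ψ hφ hψ => rw [smul_add, liftFun_add, liftFun_add, hφ, hψ, bind_add_right]
  | single x t =>
    rw [Finsupp.smul_single, liftFun_single, liftFun_single, smul_eq_mul, weight_mul]

/-- Compatibility with `μ` in Kleisli form. Both sides are additive in `Φ`; on a single term `s φ`
it becomes the scalar rule `liftFun_smul`. -/
theorem liftFun_mult {X : Type u} (Φ : (X →₀ S) →₀ S) :
    liftFun g X (Φ.sum fun φ s => s • φ) =
      bind T.obj (liftFun g (X →₀ S) Φ) (liftFun g X) := by
  induction Φ using Finsupp.induction_linear with
  | zero => rw [Finsupp.sum_zero_index, liftFun_zero, liftFun_zero, zero_bind]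
  | add Φ Ψ hΦ hΨ =>
    rw [Finsupp.sum_add_index' (h := fun (φ : X →₀ S) (s : S) => s • φ)
      (fun _ => zero_smul _ _) (fun _ _ _ => add_smul _ _ _),
      liftFun_add, liftFun_add, hΦ, hΨ, bind_add]
  | single φ s =>
    rw [Finsupp.sum_single_index (h := fun (φ : X →₀ S) (s : S) => s • φ) (zero_smul _ _),
      liftFun_single, liftFun_smul]
    exact (weight_bind g φ s (liftFun g X)).symm

/-- The monad map `M_S → T` of a semiring homomorphism `S → T(1)`. -/
noncomputable def lift : multisetFunctor.obj S ⟶ T :=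
  ObjectProperty.homMk
    { app := fun X => ↾(liftFun g X)
      naturality := fun X _ f => type_ext fun φ : X →₀ S => liftFun_mapDomain g f φ
      app_η := fun X => type_ext fun x : X => (liftFun_single g x 1).trans (weight_one g x)
      -- The monad map axiom applies the lift after `M_S` of the lift; naturality turns this into
      -- the Kleisli form.
      app_μ := fun X => type_ext fun Φ : (X →₀ S) →₀ S =>
        (liftFun_mult g Φ).trans
          (congrArg (mult T.obj) (liftFun_mapDomain g (liftFun g X) Φ).symm) }

end Lift

/-! ### Semiring homomorphisms from monad maps. -/

section Transpose

variable {S : CommSemiRingCat.{u}} {T : ACMnd.{u}} (σ : multisetFunctor.obj S ⟶ T)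

theorem app_multiset_add {X : Type u} (φ ψ : X →₀ S) :
    σ.hom.app X (φ + ψ : X →₀ S) = add T.property.2 (σ.hom.app X φ) (σ.hom.app X ψ) :=
  (congrArg (σ.hom.app X) (multiset_add φ ψ).symm).trans
    (app_add σ.hom (multiset_isAdditive S) T.property.2 _ _)

theorem app_multiset_zero {X : Type u} :
    σ.hom.app X (0 : X →₀ S) = zero T.property.2 :=
  (congrArg (σ.hom.app X) multiset_zero.symm).trans
    (app_zero σ.hom (multiset_isAdditive S) T.property.2)

/-- Makes `s ↦ s •` multiplicative from `S` to `M_S(1)`, so that following it with `σ_1` gives a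
semiring homomorphism. -/
theorem multiset_mul (s t : S) :
    mul (multisetMonad S) (Finsupp.single PUnit.unit s : PUnit.{u + 1} →₀ S)
      (Finsupp.single PUnit.unit t : PUnit.{u + 1} →₀ S) =
        (Finsupp.single PUnit.unit (s * t) : PUnit.{u + 1} →₀ S) := by
  refine (mul_eq _ _ _).trans ((multiset_bind S _ _).trans ((Finsupp.sum_single_index
    (h := fun (_ : PUnit.{u + 1}) (s : S) => s • Finsupp.single PUnit.unit.{u + 1} t)
    (zero_smul _ _)).trans ?_))
  rw [Finsupp.smul_single, smul_eq_mul]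

/-- The semiring homomorphism `S → T(1)`, `s ↦ σ_1(s •)`, of a monad map `σ : M_S → T`. -/
noncomputable def transpose : S ⟶ evalFunctor.obj T :=
  letI := evalSemiring T
  CommSemiRingCat.ofHom
    { toFun := fun s => σ.hom.app PUnit.{u + 1} (Finsupp.single PUnit.unit s : PUnit.{u + 1} →₀ S)
      map_one' := app_unit σ.hom PUnit.unit
      map_mul' := fun s t =>
        (congrArg (σ.hom.app PUnit.{u + 1}) (multiset_mul s t).symm).trans
          ((evalFunctor.map σ).hom.map_mul _ _)
      map_zero' := (congrArg (σ.hom.app PUnit.{u + 1})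
        (Finsupp.single_zero PUnit.unit.{u + 1})).trans (app_multiset_zero σ)
      map_add' := fun s t => (congrArg (σ.hom.app PUnit.{u + 1})
        (Finsupp.single_add PUnit.unit.{u + 1} s t)).trans (app_multiset_add σ _ _) }

/-- Naturality of `σ` along `x : 1 → X`, evaluated at `s •`. -/
theorem weight_transpose {X : Type u} (x : X) (s : S) :
    weight (transpose σ) x s = σ.hom.app X (Finsupp.single x s : X →₀ S) :=
  (app_fmap σ.hom (fun _ : PUnit.{u + 1} => x)
    (Finsupp.single PUnit.unit s : PUnit.{u + 1} →₀ S)).symm.trans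
    (congrArg (σ.hom.app X) Finsupp.mapDomain_single)

/-- The uniqueness half of the bijection: both sides are additive in `φ`, and they agree on single
terms. -/
theorem liftFun_transpose {X : Type u} (φ : X →₀ S) :
    liftFun (transpose σ) X φ = σ.hom.app X φ := by
  induction φ using Finsupp.induction_linear with
  | zero => exact (app_multiset_zero σ).symm
  | add φ ψ hφ hψ =>
    rw [liftFun_add, hφ, hψ]
    exact (app_multiset_add σ φ ψ).symm
  | single x s => rw [liftFun_single, weight_transpose]

theorem lift_transpose : lift (transpose σ) = σ := by
  apply ObjectProperty.hom_ext
  apply MonadHom.ext'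
  funext X
  exact type_ext (liftFun_transpose σ)

theorem transpose_lift (g : S ⟶ evalFunctor.obj T) : transpose (lift g) = g := by
  ext s
  exact (liftFun_single g PUnit.unit s).trans (weight_punit g s)

end Transpose

/-! ### The adjunctions -/

/-- The bijection between monad maps `M_S → T` and semiring homomorphisms `S → T(1)`. -/
noncomputable def multisetHomEquiv (S : CommSemiRingCat.{u}) (T : ACMnd.{u}) :
    (multisetFunctor.obj S ⟶ T) ≃ (S ⟶ evalFunctor.obj T) where
  toFun := transpose
  invFun := lift
  left_inv := lift_transpose
  right_inv := transpose_lift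

/-- Besides naturality in `S`, the case where `f` is the involution `*` is what relates the two
notions of involutive morphism. -/
theorem transpose_map_comp {S R : CommSemiRingCat.{u}} {T : ACMnd.{u}} (f : S ⟶ R)
    (σ : multisetFunctor.obj R ⟶ T) :
    transpose (multisetFunctor.map f ≫ σ) = f ≫ transpose σ := by
  ext s
  exact congrArg (σ.hom.app PUnit.{u + 1})
    (Finsupp.mapRange_single (f := f.hom) (hf := map_zero f.hom) (a := PUnit.unit.{u + 1}))

theorem transpose_comp {S : CommSemiRingCat.{u}} {T T' : ACMnd.{u}}
    (σ : multisetFunctor.obj S ⟶ T) (τ : T ⟶ T') :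
    transpose (σ ≫ τ) = transpose σ ≫ evalFunctor.map τ :=
  rfl

/-- Naturality of the inverse bijection follows from that of `transpose` by injectivity. -/
theorem lift_comp {S R : CommSemiRingCat.{u}} {T : ACMnd.{u}} (f : S ⟶ R)
    (g : R ⟶ evalFunctor.obj T) : lift (f ≫ g) = multisetFunctor.map f ≫ lift g :=
  (multisetHomEquiv S T).injective <| (transpose_lift _).trans <|
    ((transpose_map_comp f (lift g)).trans (congrArg (f ≫ ·) (transpose_lift g))).symm

/-- The adjunction `ℳ ⊣ ℰ`. -/
noncomputable def multisetAdjunction : multisetFunctor.{u} ⊣ evalFunctor.{u} :=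
  Adjunction.mkOfHomEquiv
    { homEquiv := multisetHomEquiv
      homEquiv_naturality_left_symm := lift_comp
      homEquiv_naturality_right := transpose_comp }

/-! ### Restriction to involutive structures. -/

/-- The bijection between maps of involutive monads `M_S → T` and homomorphisms of involutive
semirings `S → T(1)`. -/
noncomputable def involutiveHomEquiv (S : ICSRng.{u}) (T : IACMnd.{u}) :
    (involutiveMultisetFunctor.obj S ⟶ T) ≃ (S ⟶ involutiveEvalFunctor.obj T) where
  toFun σ :=
    { toRingHom := (transpose σ.hom).hom
      map_star := fun s => by
        -- Transposing `σ ∘ ζ = ζ' ∘ σ` gives preservation of `*`: precomposition with `ℳ(*)`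
        -- becomes precomposition with `*`, and postcomposition with `ζ'` becomes postcomposition
        -- with `ζ'_1`.
        have hs : transpose (multisetInvolution S ≫ σ.hom) = transpose (σ.hom ≫ T.ζ) :=
          congrArg transpose σ.comm
        have hl : transpose (multisetInvolution S ≫ σ.hom) =
            CommSemiRingCat.ofHom (starRingEnd S.carrier) ≫ transpose σ.hom :=
          transpose_map_comp (S := CommSemiRingCat.of S.carrier)
            (CommSemiRingCat.ofHom (starRingEnd S.carrier)) σ.hom
        exact ConcreteCategory.congr_hom (hl.symm.trans hs) s }
  invFun g :=
    { hom := lift (S := ICSRng.forget.obj S) (ICSRng.forget.map g)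
      -- The same equivalence read backwards: after transposing, the two sides are `g ∘ *` and `* ∘
      -- g`.
      comm := (multisetHomEquiv _ _).injective <| by
        refine (transpose_map_comp (S := CommSemiRingCat.of S.carrier)
          (CommSemiRingCat.ofHom (starRingEnd S.carrier)) _).trans
          (Eq.trans ?_ (transpose_comp _ _).symm)
        have hg := transpose_lift (S := ICSRng.forget.obj S) (T := T.toACMnd) (ICSRng.forget.map g)
        refine (congrArg (_ ≫ ·) hg).trans (Eq.trans ?_ (congrArg (· ≫ _) hg).symm)
        ext s
        exact g.map_star s }
  left_inv σ := IACMnd.Hom.ext (lift_transpose σ.hom)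
  right_inv g := ICSRng.Hom.ext
    (congrArg CommSemiRingCat.Hom.hom (transpose_lift (ICSRng.forget.map g)))

/-- The adjunction `ℳ ⊣ ℰ` between involutive semirings and involutive monads. -/
noncomputable def involutiveAdjunction :
    involutiveMultisetFunctor.{u} ⊣ involutiveEvalFunctor.{u} :=
  Adjunction.mkOfHomEquiv
    { homEquiv := involutiveHomEquiv
      homEquiv_naturality_left_symm := fun f g => IACMnd.Hom.ext <|
        lift_comp (ICSRng.forget.map f) (ICSRng.forget.map g)
      homEquiv_naturality_right := fun _ _ => rfl }

end AddMonads

theorem mainTheorem9 :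
    -- the functors restrict along the functors forgetting the involutions
    AddMonads.involutiveMultisetFunctor.{u} ⋙ AddMonads.IACMnd.forget =
        AddMonads.ICSRng.forget ⋙ AddMonads.multisetFunctor ∧
    AddMonads.involutiveEvalFunctor.{u} ⋙ AddMonads.ICSRng.forget =
        AddMonads.IACMnd.forget ⋙ AddMonads.evalFunctor ∧
    -- the involution on `M_S` is `∑ sᵢ xᵢ ↦ ∑ sᵢ* xᵢ`
    (∀ (S : AddMonads.ICSRng.{u}) (X : Type u) (φ : X →₀ S.carrier),
      (AddMonads.involutiveMultisetFunctor.obj S).ζ.hom.app X φ =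
        φ.mapRange star (star_zero S.carrier)) ∧
    -- the involution on `T(1)` is `ζ_1`
    (∀ (T : AddMonads.IACMnd.{u}) (a : (AddMonads.involutiveEvalFunctor.obj T).carrier),
      star a = T.ζ.hom.app PUnit.{u + 1} a) ∧
    -- the adjunction `ℳ ⊣ ℰ`, and its restriction to the involutive structures
    ∃ (adj : AddMonads.multisetFunctor.{u} ⊣ AddMonads.evalFunctor.{u})
      (adj' : AddMonads.involutiveMultisetFunctor.{u} ⊣ AddMonads.involutiveEvalFunctor.{u}),
      (∀ (S : CommSemiRingCat.{u}) (T : AddMonads.ACMnd.{u})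
          (σ : AddMonads.multisetFunctor.obj S ⟶ T) (s : S),
        (adj.homEquiv S T σ).hom s =
          σ.hom.app PUnit.{u + 1} (Finsupp.single PUnit.unit s : PUnit.{u + 1} →₀ S)) ∧
      (∀ (S : AddMonads.ICSRng.{u}) (T : AddMonads.IACMnd.{u})
          (σ : AddMonads.involutiveMultisetFunctor.obj S ⟶ T),
        AddMonads.ICSRng.forget.map (adj'.homEquiv S T σ) =
          adj.homEquiv (AddMonads.ICSRng.forget.obj S) (AddMonads.IACMnd.forget.obj T)
            (AddMonads.IACMnd.forget.map σ)) := by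
  -- The restriction claims and the formulas for the involutions hold by definition; only the
  -- hom-set bijections need unfolding.
  refine ⟨rfl, rfl, fun _ _ _ => rfl, fun _ _ => rfl, AddMonads.multisetAdjunction,
    AddMonads.involutiveAdjunction, fun S T σ s => ?_, fun S T σ => ?_⟩
  -- The hom-set bijection of the adjunction is the one it was built from, so the formula is the
  -- definition of `transpose`.
  · have h : AddMonads.multisetAdjunction.homEquiv S T = AddMonads.multisetHomEquiv S T := by
      rw [AddMonads.multisetAdjunction, Adjunction.mkOfHomEquiv_homEquiv]
    rw [h]
    rfl
  · rw [AddMonads.multisetAdjunction, AddMonads.involutiveAdjunction,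
      Adjunction.mkOfHomEquiv_homEquiv, Adjunction.mkOfHomEquiv_homEquiv]
    rfl
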